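/- Let $\Gamma=(V,E)$ be a finite simple digraph (no self-loops, no multiple edges), let $G$ be a point group in dimension $d$ (a finite subgroup of $\mathrm{O}(d)$), and let $\rho:E\to G$. A semi-walk of $\Gamma$ traverses edges forwards or backwards; a walk traverses them forwards only; a path is a walk without repeated vertices. The net voltage $f(w)$ of a semi-walk $w$ is the ordered product of the voltages of its edges, with $\rho(e)^{-1}$ in place of $\rho(e)$ for an edge $e$ traversed backwards, and $f(w)=\mathbf 1$ if $w$ is a single vertex. Put $\mathrm{Net}(v_i,v_j)=\{f(w) : w \text{ a semi-walk from } v_i \text{ to } v_j\}$, $\mathrm{Net}(v_i,V)=\bigcup_{v_j\in V}\mathrm{Net}(v_i,v_j)$, $G_i=\mathrm{Net}(v_i,v_i)$ (the local group at $v_i$), and $G_i^*=\{f(w) : w\text{ a closed walk at }v_i\}$ (the directed local group). The voltage graph $(\Gamma,\rho)$ is nondegenerate if $\mathrm{Net}(v_i,V)=G$ for some vertex $v_i$. A root is a vertex that can be reached from every vertex by a path. The adapted partition $V=\bigsqcup_{l=1}^m V_l$ is the one in which $v_i$ and $v_j$ lie in the same part if and only if there is a semi-walk $w$ from $v_i$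 to $v_j$ with $f(w)=\mathbf 1$. Suppose that $\Gamma$ is rooted and that $G_i=G_i^*$ for some root $v_i$. Then: 1. For every fixed vertex $v_i$, two vertices $v_j$ and $v_k$ lie in the same part of the adapted partition if and only if $\mathrm{Net}(v_i,v_j)=\mathrm{Net}(v_i,v_k)$. Moreover, the number of parts is $$m=\frac{|\mathrm{Net}(v_i,V)|}{|G_i|}\le\frac{|G|}{|G_i|},$$ with equality if and only if $(\Gamma,\rho)$ is nondegenerate. 2. Let $a_{ij}>0$ for every edge $v_i\to v_j$, and let $p(t)=(x_1(t),\dots,x_N(t))$, $t\ge 0$, with $x_i(t)\in\mathbb R^d$, be a trajectory of $$\dot x_i=\sum_{j\,:\,v_i\to v_j\in E}a_{ij}\,\bigl(\rho(v_i\to v_j)\,x_j-x_i\bigr),\qquad i=1,\dots,N=|V|,$$ that converges to $p^*=(x_1^*,\dots,x_N^*)$ as $t\to\infty$. Then $x_i^*=x_j^*$ whenever $v_i$ and $v_j$ lie in the same part of the adapted partition. -/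

import Mathlib

/-- A voltage graph: a simple digraph (no multiple edges, no self-loops) on `V` together with a
map from its edges to the group `G`. -/
structure VoltageGraph (V G : Type*) where
  graph : Digraph V
  loopless : ∀ v, ¬ graph.Adj v v
  /-- The group element assigned to the edge `i → j`. -/
  voltage : ∀ {i j : V}, graph.Adj i j → G

/-- Semi-walks of a digraph: each edge is traversed forwards (`fwd`) or backwards (`bwd`). -/
inductive SemiWalk {V : Type*} (Γ : Digraph V) : V → V → Type _
  | nil (u : V) : SemiWalk Γ u u
  | fwd {u v w : V} (h : Γ.Adj u v) (p : SemiWalk Γ v w) : SemiWalk Γ u w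
  | bwd {u v w : V} (h : Γ.Adj v u) (p : SemiWalk Γ v w) : SemiWalk Γ u w

namespace SemiWalk

variable {V : Type*} {Γ : Digraph V}

/-- The semi-walk is a walk: every edge is traversed forwards. -/
def IsWalk : ∀ {u v : V}, SemiWalk Γ u v → Prop
  | _, _, nil _ => True
  | _, _, fwd _ p => p.IsWalk
  | _, _, bwd _ _ => False

/-- The list of vertices visited by a semi-walk, with repetitions. -/
def support : ∀ {u v : V}, SemiWalk Γ u v → List V
  | u, _, nil _ => [u]
  | u, _, fwd _ p => u :: p.support
  | u, _, bwd _ p => u :: p.support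

/-- A path is a walk without repeated vertices. -/
def IsPath {u v : V} (p : SemiWalk Γ u v) : Prop := p.IsWalk ∧ p.support.Nodup

/-- Concatenation of semi-walks. -/
def append : ∀ {u v w : V}, SemiWalk Γ u v → SemiWalk Γ v w → SemiWalk Γ u w
  | _, _, _, nil _, q => q
  | _, _, _, fwd h p, q => fwd h (p.append q)
  | _, _, _, bwd h p, q => bwd h (p.append q)

/-- The inverse of a semi-walk. -/
def inverse : ∀ {u v : V}, SemiWalk Γ u v → SemiWalk Γ v u
  | _, _, nil u => nil u
  | _, _, fwd h p => p.inverse.append (bwd h (nil _))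
  | _, _, bwd h p => p.inverse.append (fwd h (nil _))

end SemiWalk

namespace VoltageGraph

variable {V G : Type*}

/-- `r` is a root: from every vertex there is a path to `r`. -/
def IsRoot (Γ : VoltageGraph V G) (r : V) : Prop :=
  ∀ v, ∃ p : SemiWalk Γ.graph v r, p.IsPath

/-- The voltage graph is rooted: it has at least one root. -/
def Rooted (Γ : VoltageGraph V G) : Prop := ∃ r, Γ.IsRoot r

variable [Group G]

/-- The net voltage on a semi-walk. -/
def net (Γ : VoltageGraph V G) : ∀ {u v : V}, SemiWalk Γ.graph u v → G
  | _, _, .nil _ => 1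
  | _, _, .fwd h p => Γ.voltage h * Γ.net p
  | _, _, .bwd h p => (Γ.voltage h)⁻¹ * Γ.net p

theorem net_append (Γ : VoltageGraph V G) {u v w : V} (p : SemiWalk Γ.graph u v)
    (q : SemiWalk Γ.graph v w) : Γ.net (p.append q) = Γ.net p * Γ.net q := by
  induction p with
  | nil u => simp [SemiWalk.append, net]
  | fwd h p ih => simp [SemiWalk.append, net, ih, mul_assoc]
  | bwd h p ih => simp [SemiWalk.append, net, ih, mul_assoc]

theorem net_inverse (Γ : VoltageGraph V G) {u v : V} (p : SemiWalk Γ.graph u v) :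
    Γ.net p.inverse = (Γ.net p)⁻¹ := by
  induction p with
  | nil u => simp [SemiWalk.inverse, net]
  | fwd h p ih => simp [SemiWalk.inverse, net, net_append, ih]
  | bwd h p ih => simp [SemiWalk.inverse, net, net_append, ih]

/-- `Net(u, v)`: the net voltages on the semi-walks from `u` to `v`. -/
def netSet (Γ : VoltageGraph V G) (u v : V) : Set G :=
  {g | ∃ p : SemiWalk Γ.graph u v, Γ.net p = g}

/-- `Net(u, V)`: the net voltages on the semi-walks that start at `u`. -/
def netFrom (Γ : VoltageGraph V G) (u : V) : Set G := ⋃ v, Γ.netSet u v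

/-- The local group at `v`: the net voltages on the closed semi-walks at `v`. -/
def localGroup (Γ : VoltageGraph V G) (v : V) : Subgroup G where
  carrier := {g | ∃ p : SemiWalk Γ.graph v v, Γ.net p = g}
  mul_mem' := by
    rintro _ _ ⟨p, rfl⟩ ⟨q, rfl⟩
    exact ⟨p.append q, Γ.net_append p q⟩
  one_mem' := ⟨.nil v, rfl⟩
  inv_mem' := by
    rintro _ ⟨p, rfl⟩
    exact ⟨p.inverse, Γ.net_inverse p⟩

/-- The directed local group at `v`: the net voltages on the closed walks at `v`. -/
def directedLocalGroup (Γ : VoltageGraph V G) (v : V) : Set G :=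
  {g | ∃ p : SemiWalk Γ.graph v v, p.IsWalk ∧ Γ.net p = g}

/-- Nondegeneracy: from some vertex, all of `G` occurs as net voltages. -/
def Nondegenerate (Γ : VoltageGraph V G) : Prop := ∃ v, Γ.netFrom v = Set.univ

/-- Two vertices are related if a semi-walk of net voltage `1` joins them. -/
def adaptedSetoid (Γ : VoltageGraph V G) : Setoid V where
  r u v := ∃ p : SemiWalk Γ.graph u v, Γ.net p = 1
  iseqv :=
    { refl := fun u => ⟨.nil u, rfl⟩
      symm := by
        rintro u v ⟨p, hp⟩
        exact ⟨p.inverse, by rw [net_inverse, hp, inv_one]⟩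
      trans := by
        rintro u v w ⟨p, hp⟩ ⟨q, hq⟩
        exact ⟨p.append q, by rw [net_append, hp, hq, one_mul]⟩ }

/-- The adapted partition of the vertex set, as the set of its parts. -/
def adaptedPartition (Γ : VoltageGraph V G) : Set (Set V) := Γ.adaptedSetoid.classes

end VoltageGraph

open scoped Classical in
/-- The velocity of agent `i` in the clustering dynamics: the sum over the out-neighbours `j` of
`i` of `a i j • (θ_ij x_j - x_i)`, where the matrix `θ_ij` is the voltage of `i → j`. -/
noncomputable def VoltageGraph.velocity {V : Type*} [Fintype V] {d : ℕ}
    {G : Subgroup (Matrix.orthogonalGroup (Fin d) ℝ)} (Γ : VoltageGraph V G)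
    (a : V → V → ℝ) (p : V → EuclideanSpace ℝ (Fin d)) (i : V) : EuclideanSpace ℝ (Fin d) :=
  ∑ j : {j : V // Γ.graph.Adj i j},
    a i j • (Matrix.toEuclideanLin
      ((Γ.voltage j.2 : Matrix.orthogonalGroup (Fin d) ℝ) : Matrix (Fin d) (Fin d) ℝ) (p j) - p i)

/-- `x` is a trajectory on `[0, ∞)` of the clustering dynamics (with a one-sided derivative
at `0`). -/
def VoltageGraph.IsTrajectory {V : Type*} [Fintype V] {d : ℕ}
    {G : Subgroup (Matrix.orthogonalGroup (Fin d) ℝ)} (Γ : VoltageGraph V G)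
    (a : V → V → ℝ) (x : ℝ → V → EuclideanSpace ℝ (Fin d)) : Prop :=
  ∀ t : ℝ, 0 ≤ t → ∀ i : V,
    HasDerivWithinAt (fun s => x s i) (Γ.velocity a (x t) i) (Set.Ici 0) t

/-!
The combinatorial part holds because `Γ` is rooted, hence weakly connected. Every semi-walk from
`i` to `j` with net voltage `g` shows `Net(i, j) = G_i g`, a right coset of the local group, and
two such cosets `Net(i, j)`, `Net(i, k)` coincide or are disjoint, according to whether `j` and
`k` are in the same part of the adapted partition (`adaptedSetoid_iff_netSet_eq`). Hence
`Net(i, V)` is the disjoint union, over the parts, of sets of size `|G_i|`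
(`ncard_netFrom`). Moving the base point from `i` to `j` translates `Net(i, V)`, so
nondegeneracy can be tested at any vertex (`nondegenerate_iff`).

For the dynamics, the limit of a convergent trajectory is an equilibrium, because a differentiable
function which converges together with its derivative has derivative tending to zero. Equilibria
form a linear space and obey a maximum principle: at a vertex of maximal norm, `x_i` is a convex
combination of the vectors `ρ(i → j) x_j`, none of them longer, so that `x_i = ρ(i → j) x_j` for
all out-neighbours `j`, and the norm is maximal at these as well (`IsEquilibrium.eq_voltage`).
Two consequences follow for a root `r`. The norm is maximal at `r`, so `x_r` is fixed by the directed
local group, that is, by `G_r`. Therefore `y_v = f(w) x_r`, with `w` any semi-walk from `v` to `r`,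
is well defined and is an equilibrium. The equilibrium `x - y` vanishes at `r`, where its norm is
maximal, so `x = y`. Now `x_v = f(w) x_r` for every semi-walk `w` from `v` to `r`, and vertices
joined by a semi-walk of net voltage `1` have equal limits.
-/

namespace VoltageGraph

/-! ### The adapted partition and the cosets of the local group -/

section Combinatorics

variable {V G : Type*}

theorem Rooted.nonempty_semiWalk {Γ : VoltageGraph V G} (h : Γ.Rooted) (u v : V) :
    Nonempty (SemiWalk Γ.graph u v) := by
  obtain ⟨r, hr⟩ := h
  obtain ⟨p, -⟩ := hr u
  obtain ⟨q, -⟩ := hr v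
  exact ⟨p.append q.inverse⟩

variable [Group G] {Γ : VoltageGraph V G}

theorem mul_mem_netSet {u v w : V} {g h : G} (hg : g ∈ Γ.netSet u v) (hh : h ∈ Γ.netSet v w) :
    g * h ∈ Γ.netSet u w := by
  obtain ⟨p, rfl⟩ := hg
  obtain ⟨q, rfl⟩ := hh
  exact ⟨p.append q, Γ.net_append p q⟩

theorem inv_mem_netSet {u v : V} {g : G} (hg : g ∈ Γ.netSet u v) : g⁻¹ ∈ Γ.netSet v u := by
  obtain ⟨p, rfl⟩ := hg
  exact ⟨p.inverse, Γ.net_inverse p⟩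

theorem Rooted.netSet_nonempty (h : Γ.Rooted) (u v : V) : (Γ.netSet u v).Nonempty :=
  let ⟨p⟩ := h.nonempty_semiWalk u v
  ⟨_, p, rfl⟩

/-- A common net voltage on semi-walks from `i` to `j` and from `i` to `k` puts `j` and `k` in the
same part. -/
theorem adaptedSetoid_of_mem_netSet {i j k : V} {g : G} (hj : g ∈ Γ.netSet i j)
    (hk : g ∈ Γ.netSet i k) : Γ.adaptedSetoid j k := by
  have h := mul_mem_netSet (inv_mem_netSet hj) hk
  rwa [inv_mul_cancel] at h

theorem netSet_subset_of_adaptedSetoid (i : V) {j k : V} (h : Γ.adaptedSetoid j k) :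
    Γ.netSet i j ⊆ Γ.netSet i k := by
  intro g hg
  have h1 : (1 : G) ∈ Γ.netSet j k := h
  simpa using mul_mem_netSet hg h1

theorem adaptedSetoid_iff_netSet_eq (hΓ : Γ.Rooted) (i j k : V) :
    Γ.adaptedSetoid j k ↔ Γ.netSet i j = Γ.netSet i k := by
  constructor
  · intro h
    exact (netSet_subset_of_adaptedSetoid i h).antisymm
      (netSet_subset_of_adaptedSetoid i (Γ.adaptedSetoid.symm h))
  · intro h
    obtain ⟨g, hg⟩ := hΓ.netSet_nonempty i j
    exact adaptedSetoid_of_mem_netSet hg (h ▸ hg)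

/-- `Net(i, j)` is a right coset of the local group at `i`, so the two have the same size. -/
theorem ncard_netSet (hΓ : Γ.Rooted) (i j : V) :
    (Γ.netSet i j).ncard = Nat.card (Γ.localGroup i) := by
  obtain ⟨g, hg⟩ := hΓ.netSet_nonempty i j
  have h : Γ.netSet i j = (· * g) '' (Γ.localGroup i : Set G) := by
    ext x
    constructor
    · intro hx
      exact ⟨x * g⁻¹, mul_mem_netSet hx (inv_mem_netSet hg), by simp⟩
    · rintro ⟨y, hy, rfl⟩
      exact mul_mem_netSet hy hg
  rw [h, Set.ncard_image_of_injective _ (mul_left_injective g)]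
  exact (Nat.card_coe_set_eq _).symm

theorem ncard_netFrom [Finite V] [Finite G] (hΓ : Γ.Rooted) (i : V) :
    (Γ.netFrom i).ncard = Γ.adaptedPartition.ncard * Nat.card (Γ.localGroup i) := by
  have hU : Γ.netFrom i = ⋃ q : Quotient Γ.adaptedSetoid, Γ.netSet i q.out := by
    refine Set.Subset.antisymm (Set.iUnion_subset fun v => ?_)
      (Set.iUnion_subset fun q => Set.subset_iUnion (Γ.netSet i) q.out)
    refine (netSet_subset_of_adaptedSetoid i
      (Γ.adaptedSetoid.symm (Quotient.mk_out (s := Γ.adaptedSetoid) v))).trans ?_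
    exact Set.subset_iUnion (fun q : Quotient Γ.adaptedSetoid => Γ.netSet i q.out) ⟦v⟧
  have hdisj : Pairwise
      (Function.onFun Disjoint fun q : Quotient Γ.adaptedSetoid => Γ.netSet i q.out) := by
    intro q q' hne
    refine Set.disjoint_left.2 fun g hg hg' => hne ?_
    exact Quotient.out_equiv_out.1 (adaptedSetoid_of_mem_netSet hg hg')
  rw [hU, Set.ncard_iUnion_of_finite (fun _ => Set.toFinite _) hdisj]
  have := Fintype.ofFinite (Quotient Γ.adaptedSetoid)
  simp only [ncard_netSet hΓ, finsum_eq_sum_of_fintype, Finset.sum_const, Finset.card_univ,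
    smul_eq_mul, ← Nat.card_eq_fintype_card]
  rw [Nat.card_congr Γ.adaptedSetoid.quotientEquivClasses, Nat.card_coe_set_eq]
  rfl

theorem nondegenerate_iff (hΓ : Γ.Rooted) (i : V) :
    Γ.Nondegenerate ↔ Γ.netFrom i = Set.univ := by
  refine ⟨?_, fun h => ⟨i, h⟩⟩
  rintro ⟨v, hv⟩
  obtain ⟨g, hg⟩ := hΓ.netSet_nonempty i v
  refine Set.eq_univ_of_forall fun x => ?_
  obtain ⟨w, hw⟩ := Set.mem_iUnion.1 (hv ▸ Set.mem_univ (g⁻¹ * x))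
  exact Set.mem_iUnion.2 ⟨w, by simpa using mul_mem_netSet hg hw⟩

end Combinatorics

/-! ### Equilibria of the clustering dynamics -/

section Equilibria

variable {V G E : Type*} [Fintype V] [Group G] [NormedAddCommGroup E] [InnerProductSpace ℝ E]
  {Γ : VoltageGraph V G} {φ : G →* Module.End ℝ E} {a : V → V → ℝ} {x y : V → E}

open scoped Classical in
/-- `x` is a stationary point of the clustering dynamics with weights `a`, where the voltages act
on the state space `E` of the agents by the representation `φ`. -/
def IsEquilibrium (Γ : VoltageGraph V G) (φ : G →* Module.End ℝ E) (a : V → V → ℝ)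
    (x : V → E) : Prop :=
  ∀ i, ∑ j : {j : V // Γ.graph.Adj i j}, a i j • (φ (Γ.voltage j.2) (x j) - x i) = 0

theorem IsEquilibrium.sub (hx : Γ.IsEquilibrium φ a x) (hy : Γ.IsEquilibrium φ a y) :
    Γ.IsEquilibrium φ a (x - y) := by
  intro i
  rw [← sub_zero (0 : E)]
  nth_rewrite 1 [← hx i]
  rw [← hy i, ← Finset.sum_sub_distrib]
  refine Finset.sum_congr rfl fun j _ => ?_
  simp only [Pi.sub_apply, map_sub, ← smul_sub]
  congr 1
  abel

/-- The maximum principle: at a vertex of maximal norm, an equilibrium is constant along the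
outgoing edges, up to the action of the voltages. -/
theorem IsEquilibrium.eq_voltage (hx : Γ.IsEquilibrium φ a x) (hφ : ∀ g v, ‖φ g v‖ = ‖v‖)
    (ha : ∀ i j, Γ.graph.Adj i j → 0 < a i j) {i j : V} (hij : Γ.graph.Adj i j)
    (hmax : ∀ k, ‖x k‖ ≤ ‖x i‖) : x i = φ (Γ.voltage hij) (x j) := by
  classical
  -- By Cauchy-Schwarz, the terms of the equilibrium equation have nonpositive inner product with
  -- `x i`, and these inner products sum to zero.
  have hle : ∀ k : {k : V // Γ.graph.Adj i k},
      inner ℝ (x i) (φ (Γ.voltage k.2) (x k)) ≤ ‖x i‖ ^ 2 := fun k =>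
    calc inner ℝ (x i) (φ (Γ.voltage k.2) (x k)) ≤ ‖x i‖ * ‖φ (Γ.voltage k.2) (x k)‖ :=
          real_inner_le_norm _ _
      _ ≤ ‖x i‖ * ‖x i‖ := by
          rw [hφ]
          exact mul_le_mul_of_nonneg_left (hmax k) (norm_nonneg _)
      _ = ‖x i‖ ^ 2 := (sq _).symm
  have hsum : ∑ k : {k : V // Γ.graph.Adj i k},
      a i k * (‖x i‖ ^ 2 - inner ℝ (x i) (φ (Γ.voltage k.2) (x k))) = 0 := by
    have h := congrArg (fun v => -inner ℝ (x i) v) (hx i)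
    simp only [inner_sum, inner_smul_right, inner_sub_right, real_inner_self_eq_norm_sq,
      inner_zero_right, neg_zero, ← Finset.sum_neg_distrib] at h
    rw [← h]
    exact Finset.sum_congr rfl fun k _ => by ring
  have hzero := (Finset.sum_eq_zero_iff_of_nonneg fun (k : {k : V // Γ.graph.Adj i k}) _ =>
    mul_nonneg (ha i k k.2).le (sub_nonneg.2 (hle k))).1 hsum ⟨j, hij⟩ (Finset.mem_univ _)
  have hinner : ‖x i‖ ^ 2 - inner ℝ (x i) (φ (Γ.voltage hij) (x j)) = 0 :=
    (mul_eq_zero.1 hzero).resolve_left (ha i j hij).ne'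
  have hnorm : ‖φ (Γ.voltage hij) (x j)‖ ^ 2 ≤ ‖x i‖ ^ 2 := by
    rw [hφ]
    exact pow_le_pow_left₀ (norm_nonneg _) (hmax j) 2
  have hdist := norm_sub_sq_real (x i) (φ (Γ.voltage hij) (x j))
  have h0 : ‖x i - φ (Γ.voltage hij) (x j)‖ ^ 2 ≤ 0 := by linarith
  exact sub_eq_zero.1 (norm_eq_zero.1 (pow_eq_zero_iff two_ne_zero |>.1 (h0.antisymm (sq_nonneg _))))

theorem IsEquilibrium.eq_net_of_isWalk (hx : Γ.IsEquilibrium φ a x) (hφ : ∀ g v, ‖φ g v‖ = ‖v‖)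
    (ha : ∀ i j, Γ.graph.Adj i j → 0 < a i j) {i j : V} (p : SemiWalk Γ.graph i j)
    (hp : p.IsWalk) (hmax : ∀ k, ‖x k‖ ≤ ‖x i‖) : x i = φ (Γ.net p) (x j) := by
  induction p with
  | nil u => simp [net]
  | fwd h p ih =>
    have he := hx.eq_voltage hφ ha h hmax
    have hn := congrArg norm he
    rw [hφ] at hn
    rw [he, ih hp fun k => hn ▸ hmax k]
    simp [net]
  | bwd h p ih => exact hp.elim

/-- A vertex of maximal norm exists and has a walk to the root, along which the norm is
constant. -/
theorem IsEquilibrium.norm_le_root (hx : Γ.IsEquilibrium φ a x) (hφ : ∀ g v, ‖φ g v‖ = ‖v‖)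
    (ha : ∀ i j, Γ.graph.Adj i j → 0 < a i j) {r : V} (hr : Γ.IsRoot r) (k : V) :
    ‖x k‖ ≤ ‖x r‖ := by
  have : Nonempty V := ⟨r⟩
  obtain ⟨i, hi⟩ := Finite.exists_max fun k => ‖x k‖
  obtain ⟨p, hp, -⟩ := hr i
  have h := congrArg norm (hx.eq_net_of_isWalk hφ ha p hp hi)
  rw [hφ] at h
  exact h ▸ hi k

/-- If the voltages in the local group at a root are realised by closed walks, then an
equilibrium is determined by its value at the root, by transport along semi-walks. -/
theorem IsEquilibrium.eq_net_root (hx : Γ.IsEquilibrium φ a x) (hφ : ∀ g v, ‖φ g v‖ = ‖v‖)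
    (ha : ∀ i j, Γ.graph.Adj i j → 0 < a i j) {r : V} (hr : Γ.IsRoot r)
    (hloc : (Γ.localGroup r : Set G) = Γ.directedLocalGroup r) {i : V}
    (p : SemiWalk Γ.graph i r) : x i = φ (Γ.net p) (x r) := by
  have hfix : ∀ q : SemiWalk Γ.graph r r, φ (Γ.net q) (x r) = x r := by
    intro q
    have hq : Γ.net q ∈ (Γ.localGroup r : Set G) := ⟨q, rfl⟩
    rw [hloc] at hq
    obtain ⟨w, hw, hwq⟩ := hq
    rw [← hwq]
    exact (hx.eq_net_of_isWalk hφ ha w hw fun k => hx.norm_le_root hφ ha hr k).symm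
  have hwd : ∀ {v : V} (q q' : SemiWalk Γ.graph v r),
      φ (Γ.net q) (x r) = φ (Γ.net q') (x r) := by
    intro v q q'
    have h := hfix (q.inverse.append q')
    rw [net_append, net_inverse] at h
    conv_lhs => rw [← h, ← Module.End.mul_apply, ← map_mul, mul_inv_cancel_left]
  -- Transporting `x r` along any semi-walks to the root gives an equilibrium `y`, term by term; the
  -- equilibrium `x - y` vanishes at the root, so everywhere.
  choose w hw using hr
  set y : V → E := fun v => φ (Γ.net (w v)) (x r) with hydef
  have hy : Γ.IsEquilibrium φ a y := by
    intro i
    refine Finset.sum_eq_zero fun j _ => ?_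
    have h : y i = φ (Γ.voltage j.2) (y j) := by
      rw [hydef]
      dsimp only
      rw [hwd (w i) (.fwd j.2 (w j)), net, map_mul, Module.End.mul_apply]
    rw [← h, sub_self, smul_zero]
  have hyr : y r = x r := hfix (w r)
  have hmax := (hx.sub hy).norm_le_root hφ ha (fun v => ⟨w v, hw v⟩) i
  rw [Pi.sub_apply, Pi.sub_apply, hyr, sub_self, norm_zero, norm_le_zero_iff, sub_eq_zero] at hmax
  rw [hmax]
  exact hwd _ _

end Equilibria

end VoltageGraph

/-! ### Limits of trajectories -/

/-- If a function on `[0, ∞)` converges at infinity and so does its derivative, then the derivative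
tends to zero. -/
theorem eq_zero_of_tendsto_of_tendsto_deriv {E : Type*} [NormedAddCommGroup E] [NormedSpace ℝ E]
    {f f' : ℝ → E} {L c : E} (hf : ∀ t, 0 ≤ t → HasDerivWithinAt f (f' t) (Set.Ici 0) t)
    (hL : Filter.Tendsto f Filter.atTop (nhds L)) (hc : Filter.Tendsto f' Filter.atTop (nhds c)) :
    c = 0 := by
  -- The increments of `f` over unit intervals tend both to `0` and, by the mean value inequality
  -- for `s ↦ f s - s • c`, to `c`.
  have h0 : Filter.Tendsto (fun t => f (t + 1) - f t) Filter.atTop (nhds 0) := by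
    simpa using (hL.comp (Filter.tendsto_atTop_add_const_right _ 1 Filter.tendsto_id)).sub hL
  refine tendsto_nhds_unique (Metric.tendsto_nhds.2 fun ε hε => ?_) h0
  have hbound := Metric.tendsto_nhds.1 hc (ε / 2) (half_pos hε)
  obtain ⟨T, hT⟩ := Filter.eventually_atTop.1 hbound
  filter_upwards [Filter.eventually_ge_atTop T, Filter.eventually_ge_atTop 0] with t hTt h0t
  have hderiv : ∀ s ∈ Set.Icc t (t + 1),
      HasDerivWithinAt (fun s => f s - s • c) (f' s - c) (Set.Icc t (t + 1)) s := by
    intro s hs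
    have hsub : Set.Icc t (t + 1) ⊆ Set.Ici 0 := fun u hu => h0t.trans hu.1
    have h1 := (hf s (h0t.trans hs.1)).mono hsub
    have h2 := h1.sub ((hasDerivWithinAt_id s _).smul_const c)
    rwa [one_smul] at h2
  have hmvt := (convex_Icc t (t + 1)).norm_image_sub_le_of_norm_hasDerivWithin_le hderiv
    (fun s hs => by simpa [dist_eq_norm] using (hT s (hTt.trans hs.1)).le)
    (Set.left_mem_Icc.2 (by linarith)) (Set.right_mem_Icc.2 (by linarith))
  have hrw : f (t + 1) - (t + 1) • c - (f t - t • c) = f (t + 1) - f t - c := by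
    rw [add_smul, one_smul]
    abel
  rw [hrw, add_sub_cancel_left, norm_one, mul_one] at hmvt
  rw [dist_eq_norm]
  linarith

/-- The action of orthogonal matrices on Euclidean space. -/
noncomputable def orthogonalAction (d : ℕ) :
    Matrix.orthogonalGroup (Fin d) ℝ →* Module.End ℝ (EuclideanSpace ℝ (Fin d)) :=
  (Matrix.toLpLinAlgEquiv 2 : Matrix (Fin d) (Fin d) ℝ ≃ₐ[ℝ] _).toRingEquiv.toMonoidHom.comp
    (Submonoid.subtype _)

theorem norm_orthogonalAction {d : ℕ} (A : Matrix.orthogonalGroup (Fin d) ℝ)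
    (v : EuclideanSpace ℝ (Fin d)) : ‖orthogonalAction d A v‖ = ‖v‖ := by
  have hA : (A : Matrix (Fin d) (Fin d) ℝ).transpose * A = 1 := Matrix.UnitaryGroup.star_mul_self A
  have hsq : ‖orthogonalAction d A v‖ ^ 2 = ‖v‖ ^ 2 := by
    simp only [EuclideanSpace.real_norm_sq_eq]
    have h : ∀ w : Fin d → ℝ, ∑ i, w i ^ 2 = w ⬝ᵥ w := fun w => by simp [dotProduct, sq]
    rw [h, h]
    change Matrix.mulVec (A : Matrix (Fin d) (Fin d) ℝ) v.ofLp
      ⬝ᵥ Matrix.mulVec (A : Matrix (Fin d) (Fin d) ℝ) v.ofLp = _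
    rw [Matrix.dotProduct_mulVec, ← Matrix.mulVec_transpose, Matrix.mulVec_mulVec, hA,
      Matrix.one_mulVec]
  exact (pow_left_inj₀ (norm_nonneg _) (norm_nonneg _) two_ne_zero).1 hsq

namespace VoltageGraph

theorem IsTrajectory.isEquilibrium_of_tendsto {V : Type*} [Fintype V] {d : ℕ}
    {G : Subgroup (Matrix.orthogonalGroup (Fin d) ℝ)} {Γ : VoltageGraph V G} {a : V → V → ℝ}
    {x : ℝ → V → EuclideanSpace ℝ (Fin d)} (hx : Γ.IsTrajectory a x)
    {xlim : V → EuclideanSpace ℝ (Fin d)} (hlim : Filter.Tendsto x Filter.atTop (nhds xlim)) :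
    Γ.IsEquilibrium ((orthogonalAction d).comp G.subtype) a xlim := by
  intro i
  have hpt := tendsto_pi_nhds.1 hlim
  change Γ.velocity a xlim i = 0
  refine eq_zero_of_tendsto_of_tendsto_deriv (fun t ht => hx t ht i) (hpt i) ?_
  refine tendsto_finsetSum _ fun j _ => Filter.Tendsto.const_smul ?_ _
  exact (((LinearMap.continuous_of_finiteDimensional _).tendsto _).comp (hpt j)).sub (hpt i)

end VoltageGraph

/-! ### Counting the parts and clustering of the limits -/

theorem corollary4 {V : Type*} [Fintype V] {d : ℕ}
    (G : Subgroup (Matrix.orthogonalGroup (Fin d) ℝ)) [Finite G]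
    (Γ : VoltageGraph V G) (hrooted : Γ.Rooted)
    (hlocal : ∃ r, Γ.IsRoot r ∧ (Γ.localGroup r : Set G) = Γ.directedLocalGroup r) :
    (∀ i : V,
      (∀ j k : V, (∃ S ∈ Γ.adaptedPartition, j ∈ S ∧ k ∈ S) ↔ Γ.netSet i j = Γ.netSet i k) ∧
      (Γ.adaptedPartition.ncard : ℚ) = (Γ.netFrom i).ncard / Nat.card (Γ.localGroup i) ∧
      ((Γ.netFrom i).ncard : ℚ) / Nat.card (Γ.localGroup i)
        ≤ (Nat.card G : ℚ) / Nat.card (Γ.localGroup i) ∧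
      (((Γ.netFrom i).ncard : ℚ) / Nat.card (Γ.localGroup i)
        = (Nat.card G : ℚ) / Nat.card (Γ.localGroup i) ↔ Γ.Nondegenerate)) ∧
    (∀ a : V → V → ℝ, (∀ i j, Γ.graph.Adj i j → 0 < a i j) →
      ∀ x : ℝ → V → EuclideanSpace ℝ (Fin d), Γ.IsTrajectory a x →
        ∀ xlim : V → EuclideanSpace ℝ (Fin d),
          Filter.Tendsto x Filter.atTop (nhds xlim) →
            ∀ S ∈ Γ.adaptedPartition, ∀ i ∈ S, ∀ j ∈ S, xlim i = xlim j) := by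

  refine ⟨fun i => ?_, ?_⟩
  · have hpos : (0 : ℚ) < Nat.card (Γ.localGroup i) := by exact_mod_cast Nat.card_pos
    have hcard : (Γ.netFrom i).ncard ≤ Nat.card G := Set.ncard_le_card _
    refine ⟨fun j k => ?_, ?_, ?_, ?_⟩
    · rw [← VoltageGraph.adaptedSetoid_iff_netSet_eq hrooted]
      exact Γ.adaptedSetoid.rel_iff_exists_classes.symm
    · rw [eq_div_iff hpos.ne', VoltageGraph.ncard_netFrom hrooted i, Nat.cast_mul]
    · gcongr
    · rw [div_left_inj' hpos.ne', Nat.cast_inj, VoltageGraph.nondegenerate_iff hrooted i,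
        ← Set.ncard_univ]
      exact ⟨fun h => Set.eq_of_subset_of_ncard_le (Set.subset_univ _) h.ge, fun h => by rw [h]⟩
  · intro a ha x hx xlim hlim S hS i hi j hj
    obtain ⟨r, hr, hloc⟩ := hlocal
    obtain ⟨p, hp⟩ : Γ.adaptedSetoid i j := Γ.adaptedSetoid.rel_iff_exists_classes.2 ⟨S, hS, hi, hj⟩
    obtain ⟨q, -⟩ := hr j
    have heq := hx.isEquilibrium_of_tendsto hlim
    have hnorm : ∀ (g : G) (v : EuclideanSpace ℝ (Fin d)),
        ‖(orthogonalAction d).comp G.subtype g v‖ = ‖v‖ := fun g v => norm_orthogonalAction _ v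
    rw [heq.eq_net_root hnorm ha hr hloc (p.append q), heq.eq_net_root hnorm ha hr hloc q,
      VoltageGraph.net_append, hp, one_mul]
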